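/- A Boolean frame is an algebra $(A,\sqcap,-,0,f)$ where $(A,\sqcap,-,0)$ is a Boolean algebra and $f\colon A\to A$ is an arbitrary unary operation; a variety of Boolean frames is a class of Boolean frames defined by equations. An algebra has the congruence extension property (CEP) if every congruence of each of its subalgebras is the restriction of a congruence of the whole algebra. A variety has the CEP if all its members do, and it is monotone if in all its members $x\le y$ implies $f(x)\le f(y)$. A unary operation $g$ on a Boolean algebra is additive if $g(x\sqcup y)=g(x)\sqcup g(y)$ for all $x,y$. A variety $\mathbf V$ of Boolean frames is strongly non-additive if it is not the case that for every $(A,f)\in\mathbf V$ there is an additive operation $g$ on the Boolean algebra $A$ such that $(A,f)$ and $(A,g)$ are term-equivalent, i.e. have the same clone of term operations (the terms may depend on the algebra). For $n\ge 5$ let $\mathcal W_n$ be the wheel frame with points $0,\dots,n-1$ and $h$, in which $x,y<n$ are related iff $x-y\equiv 0,1$ or $-1\pmod n$, and $h$ is related to every point (itself included) and every point is related to $h$. Let $\mathfrak W_n$ be its complex algebra, i.e. the powerset of $\mathcal W_n$ with $f(X)=\{w : w \text{ is related to some } v\in X\}$. Let $\mathfrak A$ be the powerset algebra of $\{1,2,3\}$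 with $f(\{1,3\})=\{1,2,3\}$ and $f(X)=X$ for all other $X$. For a set $X$ of primes $\ge 5$ let $\mathbf V(X)$ be the variety generated by $\{\mathfrak W_p : p\in X\}\cup\{\mathfrak A\}$. Theorem. For every nonempty set $X$ of primes $\ge 5$, the variety $\mathbf V(X)$ is strongly non-additive and monotone and has the CEP; and $\mathbf V(X)\neq\mathbf V(Y)$ for any two distinct nonempty sets $X,Y$ of primes $\ge 5$. Consequently there are exactly $2^{\aleph_0}$ strongly non-additive, monotone varieties of Boolean frames with the CEP. -/

import Mathlib

universe u v w

/-- A Boolean frame: a Boolean algebra with an arbitrary unary operation `f`. -/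
structure BooleanFrame : Type (u + 1) where
  carrier : Type u
  [boolAlg : BooleanAlgebra carrier]
  f : carrier → carrier

namespace BooleanFrame

instance : CoeSort BooleanFrame.{u} (Type u) := ⟨BooleanFrame.carrier⟩

instance (A : BooleanFrame.{u}) : BooleanAlgebra A := A.boolAlg

/-- Terms over the variables `α` in the signature `⊓, -, 0, f`. -/
inductive Term (α : Type w) : Type w
  | var (i : α) : Term α
  | zero : Term α
  | inf (s t : Term α) : Term α
  | compl (t : Term α) : Term α
  | op (t : Term α) : Term α

/-- The value of a term under the assignment `e`, the unary symbol being interpreted as `f`. -/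
def Term.eval {α : Type w} {A : Type u} [BooleanAlgebra A] (f : A → A) (e : α → A) : Term α → A
  | .var i => e i
  | .zero => ⊥
  | .inf s t => s.eval f e ⊓ t.eval f e
  | .compl t => (t.eval f e)ᶜ
  | .op t => f (t.eval f e)

/-- Equations, in countably many variables. -/
abbrev Equation : Type := Term ℕ × Term ℕ

/-- The equation `q` holds identically in `A`. -/
def Satisfies (A : BooleanFrame.{u}) (q : Equation) : Prop :=
  ∀ e : ℕ → A, q.1.eval A.f e = q.2.eval A.f e

/-- The class of all Boolean frames satisfying every equation of `E`. -/
def Models (E : Set Equation) : Set BooleanFrame.{u} := {A | ∀ q ∈ E, A.Satisfies q}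

/-- A variety of Boolean frames is an equational class of Boolean frames. -/
def IsVariety (V : Set BooleanFrame.{u}) : Prop := ∃ E : Set Equation, V = Models E

/-- The equations that hold in all members of `K`. -/
def equationsOf (K : Set BooleanFrame.{v}) : Set Equation := {q | ∀ A ∈ K, A.Satisfies q}

/-- The variety generated by the class `K`: all Boolean frames (in any chosen universe) that satisfy
every equation valid in `K`. -/
def generatedVariety (K : Set BooleanFrame.{v}) : Set BooleanFrame.{u} := Models (equationsOf K)

theorem generatedVariety_isVariety (K : Set BooleanFrame.{v}) :
    IsVariety (generatedVariety.{u} K) := ⟨_, rfl⟩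

/-- The generated variety is the least variety containing the generators. -/
theorem generatedVariety_isLeast (K : Set BooleanFrame.{u}) :
    IsLeast {V : Set BooleanFrame.{u} | IsVariety V ∧ K ⊆ V} (generatedVariety.{u} K) := by
  refine ⟨⟨⟨_, rfl⟩, fun A hA q hq => hq A hA⟩, ?_⟩
  rintro V ⟨⟨E, rfl⟩, hK⟩ A hA q hq
  exact hA q fun B hB => hK hB q hq

/-- A subalgebra of a Boolean frame: a Boolean subalgebra closed under `f`. -/
structure Subalgebra (A : BooleanFrame.{u}) where
  toBooleanSubalgebra : BooleanSubalgebra A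
  f_mem : ∀ x ∈ toBooleanSubalgebra, A.f x ∈ toBooleanSubalgebra

/-- A subalgebra, as a Boolean frame with the restricted operations. -/
def Subalgebra.toFrame {A : BooleanFrame.{u}} (B : A.Subalgebra) : BooleanFrame.{u} where
  carrier := B.toBooleanSubalgebra
  f x := ⟨A.f x.1, B.f_mem x.1 x.2⟩

/-- The inclusion of a subalgebra. -/
def Subalgebra.incl {A : BooleanFrame.{u}} (B : A.Subalgebra) (x : B.toFrame) : A :=
  (show B.toBooleanSubalgebra from x).1

/-- A congruence: an equivalence relation compatible with `⊓, -, f`. -/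
structure Congruence (A : BooleanFrame.{u}) where
  r : A → A → Prop
  equivalence : Equivalence r
  inf : ∀ {x x' y y'}, r x x' → r y y' → r (x ⊓ y) (x' ⊓ y')
  compl : ∀ {x x'}, r x x' → r xᶜ x'ᶜ
  op : ∀ {x x'}, r x x' → r (A.f x) (A.f x')

/-- The congruence extension property of an algebra: every congruence of a subalgebra is the
restriction of a congruence of the whole algebra. -/
def HasCEP (A : BooleanFrame.{u}) : Prop :=
  ∀ (B : A.Subalgebra) (Θ : B.toFrame.Congruence),
    ∃ Ψ : A.Congruence, ∀ x y : B.toFrame, Θ.r x y ↔ Ψ.r (B.incl x) (B.incl y)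

/-- A class of algebras has the CEP if all its members do. -/
def ClassHasCEP (V : Set BooleanFrame.{u}) : Prop := ∀ A ∈ V, A.HasCEP

/-- A class of Boolean frames is monotone if the operation of each member is monotone. -/
def ClassMonotone (V : Set BooleanFrame.{u}) : Prop := ∀ A ∈ V, Monotone A.f

/-- Additive (not necessarily normal) unary operations. -/
def Additive {A : Type u} [BooleanAlgebra A] (g : A → A) : Prop :=
  ∀ x y, g (x ⊔ y) = g x ⊔ g y

/-- The `n`-ary term operations of the Boolean frame `(A, f)`. -/
def termClone {A : Type u} [BooleanAlgebra A] (f : A → A) (n : ℕ) : Set ((Fin n → A) → A) :=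
  {t | ∃ τ : Term (Fin n), ∀ e, t e = τ.eval f e}

/-- `(A, f)` and `(A, g)` are term-equivalent over the Boolean operations: they have the same clone
of term operations. -/
def TermEquivalent {A : Type u} [BooleanAlgebra A] (f g : A → A) : Prop :=
  ∀ n, termClone f n = termClone g n

/-- A class of Boolean frames is equivalent to an additive one if each of its members is
term-equivalent to a Boolean frame with an additive operation on the same Boolean algebra; the
terms may depend on the member. -/
def EquivalentToAdditive (V : Set BooleanFrame.{u}) : Prop :=
  ∀ A ∈ V, ∃ g : A → A, Additive g ∧ TermEquivalent A.f g

def StronglyNonAdditive (V : Set BooleanFrame.{u}) : Prop := ¬ EquivalentToAdditive V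

/-- The complex algebra of a relational structure `(W, R)`: the powerset of `W` with
`f X = {w | w R v for some v ∈ X}`. -/
def complexAlgebra {W : Type u} (R : W → W → Prop) : BooleanFrame.{u} where
  carrier := Set W
  f X := {w | ∃ v ∈ X, R w v}

/-- The points of the wheel frame `𝒲ₙ`: the rim `0, …, n - 1` (residues modulo `n`) and the hub. -/
inductive WheelPoint (n : ℕ) : Type
  | rim (i : ZMod n) : WheelPoint n
  | hub : WheelPoint n

/-- The accessibility relation of the wheel frame: rim points see each other iff they are equal or
cyclically adjacent, and the hub sees, and is seen from, every point. -/
def WheelRel (n : ℕ) : WheelPoint n → WheelPoint n → Prop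
  | .rim i, .rim j => i - j = 0 ∨ i - j = 1 ∨ i - j = -1
  | .hub, _ => True
  | _, .hub => True

/-- The complex algebra of the wheel frame `𝒲ₙ`. -/
def wheelAlgebra (n : ℕ) : BooleanFrame.{0} := complexAlgebra (WheelRel n)

/-- The powerset of a three-element set, with `f` fixing everything except one two-element set
`{0, 2}`, which is sent to the whole set. (The points `0, 1, 2` stand for `1, 2, 3`.) -/
def exampleAlgebra : BooleanFrame.{0} where
  carrier := Finset (Fin 3)
  f X := if X = {0, 2} then Finset.univ else X

/-- The variety generated by the wheel algebras `𝔚_p`, `p ∈ X`, and the example algebra `𝔄`. -/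
def wheelVariety (X : Set ℕ) : Set BooleanFrame.{u} :=
  generatedVariety.{u} (wheelAlgebra '' X ∪ {exampleAlgebra})

/-- The primes `≥ 5`. -/
def Prim : Set ℕ := {p | p.Prime ∧ 5 ≤ p}

end BooleanFrame

/-! The CEP rests on one term, `part`: the elements fixed by `part f a` form an ideal that contains
`a`, grows with `a` and is compatible with `f`. These demands, together with monotonicity, are
equations (`Tame`), so they need checking only in the generators. Given a congruence Θ of a
subalgebra B of A, the elements of A fixed by `part f b` for some b Θ ⊥ form the zero class of a
congruence of A. It adds nothing inside B: if d in B is fixed by `part f b`, then d = part f b d Θ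
part f ⊥ d = ⊥.

Non-additivity comes from the example algebra alone. Term-equivalent operations have the same
subalgebras and congruences; these force an additive candidate to respect equality modulo {0}, which
`exampleOp` does not.

The varieties are separated by equations tested on the generators only. In a wheel algebra `f (f a)`
is ⊤ unless `a = ⊥`, so an equation can react to whether the diagram of the p-wheel vanishes, that
is, whether the frame has a bounded morphism onto the p-wheel. Such a morphism from the q-wheel
wraps rim around rim, so p divides q (`dvd_of_wheel_boundedMorphism`); for distinct primes there is
none. An extra factor makes the equation hold in the example algebra. -/

open scoped symmDiff

namespace BooleanFrame

/-! ### Terms, homomorphisms and congruences -/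

namespace Term

variable {α : Type w}

/-- The join of two terms. -/
def sup (s t : Term α) : Term α := compl (inf (compl s) (compl t))

/-- The difference of two terms. -/
def sdiff (s t : Term α) : Term α := inf s (compl t)

/-- The symmetric difference of two terms. -/
def symm (s t : Term α) : Term α := sup (sdiff s t) (sdiff t s)

/-- The join of a finite family of terms. -/
noncomputable def finsetSup {ι : Type*} (s : Finset ι) (t : ι → Term α) : Term α :=
  (s.toList.map t).foldr sup zero

section Eval

variable {A : Type u} [BooleanAlgebra A] (f : A → A) (e : α → A)

@[simp] theorem eval_var (i : α) : (var i).eval f e = e i := rfl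

@[simp] theorem eval_zero : (zero : Term α).eval f e = ⊥ := rfl

@[simp] theorem eval_inf (s t : Term α) : (inf s t).eval f e = s.eval f e ⊓ t.eval f e := rfl

@[simp] theorem eval_compl (t : Term α) : (compl t).eval f e = (t.eval f e)ᶜ := rfl

@[simp] theorem eval_op (t : Term α) : (op t).eval f e = f (t.eval f e) := rfl

@[simp] theorem eval_sup (s t : Term α) : (sup s t).eval f e = s.eval f e ⊔ t.eval f e := by
  simp [sup]

@[simp] theorem eval_sdiff (s t : Term α) : (sdiff s t).eval f e = s.eval f e \ t.eval f e := by
  simp [sdiff, sdiff_eq]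

@[simp] theorem eval_symm (s t : Term α) : (symm s t).eval f e = s.eval f e ∆ t.eval f e := by
  simp [symm, symmDiff]

@[simp] theorem eval_finsetSup {ι : Type*} (s : Finset ι) (t : ι → Term α) :
    (finsetSup s t).eval f e = s.sup fun i => (t i).eval f e := by
  have key : ∀ l : List ι, ((l.map t).foldr sup zero).eval f e =
      (l.map fun i => (t i).eval f e).foldr (· ⊔ ·) ⊥ := by
    intro l
    induction l with
    | nil => rfl
    | cons a l ih => simp [ih]
  rw [finsetSup, key, Finset.sup_def, ← Finset.coe_toList s, Multiset.map_coe,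
    Multiset.sup_coe]

end Eval

/-- Compatible relations are compatible with all term operations. -/
theorem eval_rel {A : Type u} {B : Type v} [BooleanAlgebra A] [BooleanAlgebra B]
    {f : A → A} {g : B → B} (r : A → B → Prop) (h0 : r ⊥ ⊥)
    (hinf : ∀ {x x' y y'}, r x x' → r y y' → r (x ⊓ y) (x' ⊓ y'))
    (hcompl : ∀ {x x'}, r x x' → r xᶜ x'ᶜ) (hf : ∀ {x x'}, r x x' → r (f x) (g x'))
    {e : α → A} {e' : α → B} (he : ∀ i, r (e i) (e' i)) (t : Term α) :
    r (t.eval f e) (t.eval g e') := by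
  induction t with
  | var i => exact he i
  | zero => exact h0
  | inf s t hs ht => exact hinf hs ht
  | compl t ht => exact hcompl ht
  | op t ht => exact hf ht

end Term

namespace Congruence

variable {A : BooleanFrame.{u}} (Θ : A.Congruence)

theorem sup {x x' y y' : A} (h : Θ.r x x') (h' : Θ.r y y') : Θ.r (x ⊔ y) (x' ⊔ y') := by
  simpa using Θ.compl (Θ.inf (Θ.compl h) (Θ.compl h'))

theorem symmDiff {x x' y y' : A} (h : Θ.r x x') (h' : Θ.r y y') : Θ.r (x ∆ y) (x' ∆ y') := by
  simpa [_root_.symmDiff, sdiff_eq] using Θ.sup (Θ.inf h (Θ.compl h')) (Θ.inf h' (Θ.compl h))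

theorem rel_iff_symmDiff {x y : A} : Θ.r x y ↔ Θ.r (x ∆ y) ⊥ := by
  constructor
  · intro h
    simpa using Θ.symmDiff h (Θ.equivalence.refl y)
  · intro h
    simpa using Θ.symmDiff h (Θ.equivalence.refl y)

/-- The congruence whose zero class is a given compatible ideal. -/
def ofIdeal (I : Set A) (h0 : ⊥ ∈ I) (hle : ∀ x ∈ I, ∀ y ≤ x, y ∈ I)
    (hsup : ∀ x ∈ I, ∀ y ∈ I, x ⊔ y ∈ I) (hf : ∀ x y, x ∆ y ∈ I → A.f x ∆ A.f y ∈ I) :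
    A.Congruence where
  r x y := x ∆ y ∈ I
  equivalence :=
    { refl := fun x => by simpa using h0
      symm := fun h => by simpa [symmDiff_comm] using h
      trans := fun h h' => hle _ (hsup _ h _ h') _ (symmDiff_triangle _ _ _) }
  inf {x x' y y'} h h' := by
    refine hle _ (hsup _ h _ h') _ ?_
    refine (symmDiff_triangle _ (x' ⊓ y) _).trans (sup_le_sup ?_ ?_)
    · rw [← inf_symmDiff_distrib_right]; exact inf_le_left
    · rw [← inf_symmDiff_distrib_left]; exact inf_le_right
  compl h := by simpa using h
  op h := hf _ _ h

end Congruence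

theorem Subalgebra.incl_eval {A : BooleanFrame.{u}} (B : A.Subalgebra) {α : Type w}
    (e : α → B.toFrame) (t : Term α) :
    B.incl (t.eval B.toFrame.f e) = t.eval A.f fun i => B.incl (e i) := by
  refine Term.eval_rel (fun x y => B.incl x = y) rfl ?_ ?_ ?_ (fun _ => rfl) t
  · rintro x _ y _ rfl rfl; rfl
  · rintro x _ rfl; rfl
  · rintro x _ rfl; rfl

/-! ### A uniform description of generated congruences -/

/-- A term operation such that, in the algebras below, `c` lies in the congruence ideal generated
by `a` iff `part f a c = c`. -/
def part {A : Type u} [BooleanAlgebra A] (f : A → A) (a c : A) : A :=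
  c ⊓ (f (f a) ⊔ f (c \ a)ᶜ \ f (a ⊔ c)ᶜ)

/-- The term defining `part`. -/
def Term.part {α : Type w} (a c : Term α) : Term α :=
  .inf c (.sup (.op (.op a)) (.sdiff (.op (.compl (.sdiff c a))) (.op (.compl (.sup a c)))))

@[simp] theorem Term.eval_part {α : Type w} {A : Type u} [BooleanAlgebra A] (f : A → A) (e : α → A)
    (a c : Term α) :
    (Term.part a c).eval f e = BooleanFrame.part f (a.eval f e) (c.eval f e) := by
  simp [Term.part, BooleanFrame.part]

/-- The operation is monotone, and the elements `c` with `part f a c = c` form an ideal that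
contains `a`, increases with `a` and is compatible with `f`; all this in equational form. -/
structure Tame {A : Type u} [BooleanAlgebra A] (f : A → A) : Prop where
  mono : ∀ x y, f (x ⊓ y) ⊓ f y = f (x ⊓ y)
  part_bot : ∀ c, part f ⊥ c = ⊥
  part_self : ∀ a, part f a a = a
  part_inf : ∀ a c x, part f a (part f a c ⊓ x) = part f a c ⊓ x
  part_sup : ∀ a c d, part f a (part f a c ⊔ part f a d) = part f a c ⊔ part f a d
  part_op : ∀ a c x,
    part f a (f x ∆ f (x ∆ part f a c)) = f x ∆ f (x ∆ part f a c)
  part_mono : ∀ a b c, part f (a ⊔ b) (part f a c) = part f a c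

theorem Tame.monotone {A : Type u} [BooleanAlgebra A] {f : A → A} (h : Tame f) : Monotone f := by
  intro x y hxy
  have := h.mono x y
  rw [inf_eq_left.2 hxy] at this
  exact inf_eq_left.1 this

/-- Tameness is inherited by the generated variety. -/
theorem Tame.of_mem_generatedVariety {K : Set BooleanFrame.{v}} (hK : ∀ B ∈ K, Tame B.f)
    {A : BooleanFrame.{u}} (hA : A ∈ generatedVariety.{u} K) : Tame A.f := by
  have key : ∀ s t : Term ℕ, (∀ B ∈ K, ∀ e : ℕ → B, s.eval B.f e = t.eval B.f e) →
      ∀ a b c : A, s.eval A.f (fun n => if n = 0 then a else if n = 1 then b else c) =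
        t.eval A.f (fun n => if n = 0 then a else if n = 1 then b else c) :=
    fun s t h a b c => hA (s, t) h _
  refine ⟨fun x y => ?_, fun c => ?_, fun a => ?_, fun a c x => ?_, fun a c d => ?_,
    fun a c x => ?_, fun a b c => ?_⟩
  · simpa using key (.inf (.op (.inf (.var 0) (.var 1))) (.op (.var 1)))
      (.op (.inf (.var 0) (.var 1))) (fun B hB e => by simpa using (hK B hB).mono _ _) x y y
  · simpa using key (.part .zero (.var 0)) .zero
      (fun B hB e => by simpa using (hK B hB).part_bot _) c c c
  · simpa using key (.part (.var 0) (.var 0)) (.var 0)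
      (fun B hB e => by simpa using (hK B hB).part_self _) a a a
  · simpa using key (.part (.var 0) (.inf (.part (.var 0) (.var 1)) (.var 2)))
      (.inf (.part (.var 0) (.var 1)) (.var 2))
      (fun B hB e => by simpa using (hK B hB).part_inf _ _ _) a c x
  · simpa using key (.part (.var 0) (.sup (.part (.var 0) (.var 1)) (.part (.var 0) (.var 2))))
      (.sup (.part (.var 0) (.var 1)) (.part (.var 0) (.var 2)))
      (fun B hB e => by simpa using (hK B hB).part_sup _ _ _) a c d
  · simpa using key
      (.part (.var 0) (.symm (.op (.var 2)) (.op (.symm (.var 2) (.part (.var 0) (.var 1))))))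
      (.symm (.op (.var 2)) (.op (.symm (.var 2) (.part (.var 0) (.var 1)))))
      (fun B hB e => by simpa using (hK B hB).part_op _ _ _) a c x
  · simpa using key (.part (.sup (.var 0) (.var 1)) (.part (.var 0) (.var 2)))
      (.part (.var 0) (.var 2)) (fun B hB e => by simpa using (hK B hB).part_mono _ _ _) a b c

/-- Tame Boolean frames have the congruence extension property. -/
theorem Tame.hasCEP {A : BooleanFrame.{u}} (h : Tame A.f) : A.HasCEP := by
  intro B Θ
  have mono : ∀ {a b c : A}, a ≤ b → part A.f a c = c → part A.f b c = c := by
    intro a b c hab hc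
    have := h.part_mono a b c
    rwa [sup_eq_right.2 hab, hc] at this
  -- The zero class of the extension.
  let I : Set A := {c | ∃ b : B.toFrame, Θ.r b ⊥ ∧ part A.f (B.incl b) c = c}
  refine ⟨Congruence.ofIdeal I ⟨⊥, Θ.equivalence.refl _, h.part_bot _⟩ ?_ ?_ ?_, fun x y => ?_⟩
  · rintro x ⟨b, hb, hx⟩ y hy
    refine ⟨b, hb, ?_⟩
    have := h.part_inf (B.incl b) x y
    rwa [hx, inf_eq_right.2 hy] at this
  · rintro x ⟨b, hb, hx⟩ y ⟨b', hb', hy⟩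
    refine ⟨b ⊔ b', by simpa using Θ.sup hb hb', ?_⟩
    have hx' : part A.f (B.incl (b ⊔ b')) x = x :=
      mono (a := B.incl b) (le_sup_left : B.incl b ≤ B.incl b ⊔ B.incl b') hx
    have hy' : part A.f (B.incl (b ⊔ b')) y = y :=
      mono (a := B.incl b') (le_sup_right : B.incl b' ≤ B.incl b ⊔ B.incl b') hy
    have := h.part_sup (B.incl (b ⊔ b')) x y
    rwa [hx', hy'] at this
  · rintro x y ⟨b, hb, hxy⟩
    refine ⟨b, hb, ?_⟩
    have := h.part_op (B.incl b) (x ∆ y) x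
    rwa [hxy, symmDiff_symmDiff_cancel_left] at this
  · rw [Θ.rel_iff_symmDiff]
    have hxy : B.incl (x ∆ y) = B.incl x ∆ B.incl y := by
      simpa using B.incl_eval (fun b : Bool => cond b x y) (.symm (.var true) (.var false))
    change _ ↔ B.incl x ∆ B.incl y ∈ I
    rw [← hxy]
    constructor
    · exact fun hr => ⟨x ∆ y, hr, h.part_self _⟩
    · rintro ⟨b, hb, hc⟩
      have hval := B.incl_eval (fun i : Bool => cond i b (x ∆ y)) (.part (.var true) (.var false))
      have hbot := B.incl_eval (fun i : Bool => cond i ⊥ (x ∆ y)) (.part (.var true) (.var false))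
      -- As `part` is a term, Θ lets `b` be replaced by `⊥`; the two sides turn out to be `x ∆ y`
      -- and `⊥`.
      have hrel : Θ.r (part B.toFrame.f b (x ∆ y)) (part B.toFrame.f ⊥ (x ∆ y)) := by
        have := Term.eval_rel (f := B.toFrame.f) (g := B.toFrame.f) Θ.r (Θ.equivalence.refl _)
          Θ.inf Θ.compl Θ.op (e := fun i : Bool => cond i b (x ∆ y))
          (e' := fun i : Bool => cond i ⊥ (x ∆ y))
          (by rintro (_ | _); exacts [Θ.equivalence.refl _, hb]) (.part (.var true) (.var false))
        simpa using this
      simp only [Term.eval_part, Term.eval_var, cond_true, cond_false] at hval hbot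
      rw [hc] at hval
      rw [show B.incl ⊥ = ⊥ from rfl, h.part_bot] at hbot
      have e1 : part B.toFrame.f b (x ∆ y) = x ∆ y := Subtype.ext hval
      have e2 : part B.toFrame.f ⊥ (x ∆ y) = ⊥ := Subtype.ext hbot
      rwa [e1, e2] at hrel

/-! ### The generators are tame -/

/-- A monotone operation whose square is the unary discriminator is tame. -/
theorem Tame.of_discriminator {A : Type u} [BooleanAlgebra A] {f : A → A} (hf : Monotone f)
    (hbot : f ⊥ = ⊥) (htop : ∀ a, a ≠ ⊥ → f (f a) = ⊤) : Tame f := by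
  -- `part f a` is constantly `⊥` or the identity, according to whether `a` is `⊥`; this makes every
  -- axiom trivial.
  have h0 : ∀ c, part f ⊥ c = ⊥ := fun c => by simp [part, hbot]
  have h1 : ∀ {a}, a ≠ ⊥ → ∀ c, part f a c = c := fun ha c => by simp [part, htop _ ha]
  refine ⟨fun x y => inf_eq_left.2 (hf inf_le_right), h0, fun a => ?_, fun a c x => ?_,
    fun a c d => ?_, fun a c x => ?_, fun a b c => ?_⟩ <;>
    rcases eq_or_ne a ⊥ with rfl | ha
  · rw [h0]
  · rw [h1 ha]
  · simp [h0]
  · simp [h1 ha]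
  · simp [h0]
  · simp [h1 ha]
  · simp [h0]
  · simp [h1 ha]
  · rw [h0, bot_sup_eq]
    rcases eq_or_ne b ⊥ with rfl | hb
    · rw [h0]
    · rw [h1 hb]
  · rw [h1 ha, h1 (ne_bot_of_le_ne_bot ha le_sup_left)]

theorem complexAlgebra_monotone {W : Type u} (R : W → W → Prop) :
    Monotone (complexAlgebra R).f := by
  rintro X Y hXY w ⟨v, hv, hR⟩
  exact ⟨v, hXY hv, hR⟩

theorem wheelRel_hub_right {n : ℕ} (w : WheelPoint n) : WheelRel n w .hub := by
  cases w <;> trivial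

theorem wheelAlgebra_op_bot (n : ℕ) : (wheelAlgebra n).f ⊥ = ⊥ := by
  refine Set.eq_empty_of_forall_notMem ?_
  rintro w ⟨v, hv, -⟩
  exact hv

/-- Any two points are joined by a path of length two through the hub. -/
theorem wheelAlgebra_op_op (n : ℕ) (a : wheelAlgebra n) (ha : a ≠ ⊥) :
    (wheelAlgebra n).f ((wheelAlgebra n).f a) = ⊤ := by
  obtain ⟨v, hv⟩ : (show Set (WheelPoint n) from a).Nonempty := Set.nonempty_iff_ne_empty.2 ha
  refine Set.eq_univ_of_forall fun w => ⟨.hub, ⟨v, hv, trivial⟩, wheelRel_hub_right w⟩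

theorem wheelAlgebra_tame (n : ℕ) : Tame (wheelAlgebra n).f :=
  .of_discriminator (complexAlgebra_monotone _) (wheelAlgebra_op_bot n) (wheelAlgebra_op_op n)

/-- The operation of the example algebra, on the concrete type of its elements. -/
def exampleOp (X : Finset (Fin 3)) : Finset (Fin 3) := if X = {0, 2} then Finset.univ else X

/-- Here the second joinand of `part` is needed: the congruence ideal generated by {0} also contains
{1}, because {2} and {0, 2} have images {2} and the whole set, while `f (f {0}) = {0}`. For `a =
{0}`, `c = {1}` that joinand is `f {0, 2} \ f {2} = {0, 1}`. -/
theorem exampleOp_tame : Tame exampleOp where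
  mono := by decide +kernel
  part_bot := by decide +kernel
  part_self := by decide +kernel
  part_inf := by decide +kernel
  part_sup := by decide +kernel
  part_op := by decide +kernel
  part_mono := by decide +kernel

theorem exampleAlgebra_tame : Tame exampleAlgebra.f := exampleOp_tame

theorem tame_of_mem_wheelVariety {X : Set ℕ} {A : BooleanFrame.{u}}
    (hA : A ∈ wheelVariety.{u} X) : Tame A.f := by
  refine Tame.of_mem_generatedVariety ?_ hA
  rintro _ (⟨n, -, rfl⟩ | rfl)
  exacts [wheelAlgebra_tame n, exampleAlgebra_tame]

theorem wheelVariety_monotone (X : Set ℕ) : ClassMonotone (wheelVariety.{u} X) :=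
  fun _ hA => (tame_of_mem_wheelVariety hA).monotone

theorem wheelVariety_hasCEP (X : Set ℕ) : ClassHasCEP (wheelVariety.{u} X) :=
  fun _ hA => (tame_of_mem_wheelVariety hA).hasCEP

/-! ### Copies in higher universes -/

/-- The copy of a Boolean frame in a higher universe. -/
def lift (A : BooleanFrame.{v}) : BooleanFrame.{max u v} :=
  letI : BooleanAlgebra (ULift.{u} A) :=
    { (inferInstance : DistribLattice (ULift.{u} A)),
      (inferInstance : BoundedOrder (ULift.{u} A)) with
      compl := fun x => ⟨x.downᶜ⟩
      sdiff := fun x y => ⟨x.down \ y.down⟩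
      himp := fun x y => ⟨x.down ⇨ y.down⟩
      inf_compl_le_bot := fun x => BooleanAlgebra.inf_compl_le_bot (x := x.down)
      top_le_sup_compl := fun x => BooleanAlgebra.top_le_sup_compl (x := x.down)
      sdiff_eq := fun x y => congrArg ULift.up (_root_.sdiff_eq (x := x.down) (y := y.down))
      himp_eq := fun x y => congrArg ULift.up (_root_.himp_eq (x := x.down) (y := y.down)) }
  { carrier := ULift.{u} A
    f := fun x => ⟨A.f x.down⟩ }

/-- The underlying element of an element of the copy. -/
def lift.down {A : BooleanFrame.{v}} (x : lift.{u} A) : A := ULift.down (show ULift.{u} A from x)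

/-- The copy of an element. -/
def lift.up {A : BooleanFrame.{v}} (x : A) : lift.{u} A := ULift.up.{u} x

theorem lift.down_injective {A : BooleanFrame.{v}} :
    Function.Injective (lift.down : lift.{u} A → A) := ULift.down_injective

theorem lift.down_eval {A : BooleanFrame.{v}} {α : Type w} (e : α → lift.{u} A) (t : Term α) :
    lift.down (t.eval (lift.{u} A).f e) = t.eval A.f fun i => lift.down (e i) := by
  refine Term.eval_rel (fun (x : lift.{u} A) (y : A) => lift.down x = y) rfl ?_ ?_ ?_
    (fun _ => rfl) t
  · rintro x _ y _ rfl rfl; rfl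
  · rintro x _ rfl; rfl
  · rintro x _ rfl; rfl

theorem lift_satisfies_iff {A : BooleanFrame.{v}} {q : Equation} :
    (lift.{u} A).Satisfies q ↔ A.Satisfies q := by
  constructor
  · intro h e
    have := congrArg lift.down (h fun i => lift.up (e i))
    rwa [lift.down_eval, lift.down_eval] at this
  · intro h e
    apply lift.down_injective
    rw [lift.down_eval, lift.down_eval]
    exact h _

theorem lift_mem_generatedVariety {K : Set BooleanFrame.{v}} {A : BooleanFrame.{v}} (hA : A ∈ K) :
    lift.{u} A ∈ generatedVariety.{max u v} K :=
  fun _ hq => lift_satisfies_iff.2 (hq A hA)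

/-! ### Strong non-additivity -/

theorem lift_exampleAlgebra_not_equivalent (g : lift.{u} exampleAlgebra → lift.{u} exampleAlgebra)
    (hg : Additive g) : ¬ TermEquivalent (lift.{u} exampleAlgebra).f g := by
  intro h
  obtain ⟨σ, hσ⟩ : (fun e : Fin 1 → lift.{u} exampleAlgebra => g (e 0)) ∈
      termClone (lift.{u} exampleAlgebra).f 1 := by
    rw [h 1]
    exact ⟨.op (.var 0), fun _ => rfl⟩
  obtain ⟨τ, hτ⟩ : (fun e : Fin 1 → lift.{u} exampleAlgebra => (lift.{u} exampleAlgebra).f (e 0)) ∈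
      termClone g 1 := by
    rw [← h 1]
    exact ⟨.op (.var 0), fun _ => rfl⟩
  let up : Finset (Fin 3) → lift.{u} exampleAlgebra := lift.up (A := exampleAlgebra)
  let down : lift.{u} exampleAlgebra → Finset (Fin 3) := lift.down
  let k : Finset (Fin 3) → Finset (Fin 3) := fun x => down (g (up x))
  have hk : ∀ x y, k (x ∪ y) = k x ∪ k y := fun x y => congrArg down (hg (up x) (up y))
  have hkσ : ∀ x, k x = σ.eval exampleOp fun _ => x := fun x =>
    (congrArg down (hσ fun _ => up x)).trans (lift.down_eval _ _)
  -- `k` is a term operation of `exampleOp`, so it preserves subalgebras, here {∅, univ} and then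
  -- the one generated by {0}. `eval_rel` is used with a relation that ignores its second argument.
  have hbot : k ∅ = ∅ ∨ k ∅ = Finset.univ := by
    rw [hkσ]
    refine Term.eval_rel (f := exampleOp) (g := exampleOp)
      (fun x _ : Finset (Fin 3) => x = ∅ ∨ x = Finset.univ)
      (Or.inl rfl) ?_ ?_ ?_ (e' := fun _ => (∅ : Finset (Fin 3))) (fun _ => Or.inl rfl) σ
    · rintro x x' y y' (rfl | rfl) (rfl | rfl) <;> decide
    · rintro x x' (rfl | rfl) <;> decide
    · rintro x x' (rfl | rfl) <;> decide
  have hsing : k {0} = ∅ ∨ k {0} = {0} ∨ k {0} = {1, 2} ∨ k {0} = Finset.univ := by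
    rw [hkσ]
    refine Term.eval_rel (f := exampleOp) (g := exampleOp)
      (fun x _ : Finset (Fin 3) => x = ∅ ∨ x = {0} ∨ x = {1, 2} ∨ x = Finset.univ)
      (Or.inl rfl) ?_ ?_ ?_ (e' := fun _ => (∅ : Finset (Fin 3))) (fun _ => Or.inr (Or.inl rfl)) σ
    · rintro x x' y y' (rfl | rfl | rfl | rfl) (rfl | rfl | rfl | rfl) <;> decide
    · rintro x x' (rfl | rfl | rfl | rfl) <;> decide
    · rintro x x' (rfl | rfl | rfl | rfl) <;> decide
  -- Equality modulo {0, 1} is a congruence for `exampleOp`, hence for `k`.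
  have hcong : k ∅ ∪ {0, 1} = k {0} ∪ {0, 1} := by
    rw [hkσ, hkσ]
    refine Term.eval_rel (f := exampleOp) (g := exampleOp)
      (fun x y : Finset (Fin 3) => x ∪ {0, 1} = y ∪ {0, 1})
      rfl ?_ ?_ ?_ (fun _ => by decide) σ
    · intro x x' y y' hx hy
      simp only [Finset.inf_eq_inter]
      rw [Finset.inter_union_distrib_right, hx, hy, ← Finset.inter_union_distrib_right]
    · intro x x'
      revert x x'
      decide +kernel
    · intro x x'
      revert x x'
      decide +kernel
  -- If `k ∅ = ∅`, then `k {0}` lies below {0, 1} and in the subalgebra generated by {0}, so below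
  -- {0}, and additivity gives the claim. If `k ∅` is everything, an additive `k` is constant.
  have hrel : ∀ x y, x ∪ {0} = y ∪ {0} → k x ∪ {0} = k y ∪ {0} := by
    intro x y hxy
    have h1 : k x ∪ k {0} = k y ∪ k {0} := by rw [← hk, ← hk, hxy]
    rcases hbot with h0 | h0
    · have h2 : k {0} ⊆ {0} := by
        rw [h0] at hcong
        rcases hsing with h | h | h | h <;> rw [h] at hcong ⊢ <;> revert hcong <;> decide
      rw [← Finset.union_eq_right.2 h2, ← Finset.union_assoc, h1, Finset.union_assoc]
    · have h2 : ∀ z, k z = Finset.univ := fun z => by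
        rw [← Finset.union_empty z, hk, h0]
        exact sup_top_eq _
      rw [h2, h2]
  have hf : ∀ x y : Finset (Fin 3), x ∪ {0} = y ∪ {0} → exampleOp x ∪ {0} = exampleOp y ∪ {0} := by
    intro x y hxy
    have key := Term.eval_rel (f := g) (g := g)
      (fun x y : lift.{u} exampleAlgebra => down x ∪ {0} = down y ∪ {0}) rfl ?_ ?_ ?_
      (e := fun _ => up x) (e' := fun _ => up y) (fun _ => hxy) τ
    · rwa [← hτ, ← hτ] at key
    · intro x x' y y' hx hy
      change down x ∩ down y ∪ {0} = down x' ∩ down y' ∪ {0}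
      rw [Finset.inter_union_distrib_right, hx, hy, ← Finset.inter_union_distrib_right]
    · intro x x' hx
      change (down x)ᶜ ∪ {0} = (down x')ᶜ ∪ {0}
      ext i
      have := Finset.ext_iff.1 hx i
      simp only [Finset.mem_union, Finset.mem_compl, Finset.mem_singleton] at this ⊢
      tauto
    · intro x x' hx
      exact hrel _ _ hx
  exact absurd (hf {2} {0, 2} (by decide)) (by decide)

theorem wheelVariety_stronglyNonAdditive (X : Set ℕ) :
    StronglyNonAdditive (wheelVariety.{u} X) := by
  intro h
  obtain ⟨g, hg, hfg⟩ := h (lift.{u} exampleAlgebra) (lift_mem_generatedVariety (Or.inr rfl))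
  exact lift_exampleAlgebra_not_equivalent g hg hfg

/-! ### Diagrams of finite relational structures -/

/-- The operation of a complex algebra, on the concrete type of its elements. -/
def diamond {W : Type u} (R : W → W → Prop) (X : Set W) : Set W := {w | ∃ v ∈ X, R w v}

section Diagram

variable {W : Type v} [Fintype W]

/-- An injective coding of the points of a finite structure by variables. -/
noncomputable def code (w : W) : ℕ := (Fintype.equivFin W w).val

theorem code_injective : Function.Injective (code : W → ℕ) :=
  Fin.val_injective.comp (Fintype.equivFin W).injective

open scoped Classical in
/-- A term that vanishes in a complex algebra iff the variables indexed by the points of `(W, R)`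
are the fibres of a bounded morphism onto `(W, R)`. -/
noncomputable def diagram (R : W → W → Prop) : Term ℕ :=
  .sup (.compl (.finsetSup Finset.univ fun w : W => .var (code w)))
    (.sup
      (.finsetSup (Finset.univ.filter fun z : W × W => z.1 ≠ z.2) fun z =>
        .inf (.var (code z.1)) (.var (code z.2)))
      (.finsetSup Finset.univ fun v : W =>
        .symm (.op (.var (code v)))
          (.finsetSup (Finset.univ.filter fun w => R w v) fun w => .var (code w))))

theorem mem_finset_sup {ι : Type*} {T : Type*} (s : Finset ι) (X : ι → Set T) (x : T) :
    x ∈ s.sup X ↔ ∃ i ∈ s, x ∈ X i := by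
  simp [Finset.sup_set_eq_biUnion]

/-- The three joinands say in turn that the fibres cover, that they are disjoint, and the back and
forth conditions. -/
theorem eval_diagram_eq_empty_iff (R : W → W → Prop) {T : Type u} (S : T → T → Prop)
    (e : ℕ → Set T) :
    (diagram R).eval (A := Set T) (diamond S) e = ∅ ↔
      (∀ x, ∃ w : W, x ∈ e (code w)) ∧
      (∀ w w' : W, w ≠ w' → ∀ x, x ∈ e (code w) → x ∉ e (code w')) ∧
      ∀ (v : W) (x : T), (∃ y ∈ e (code v), S x y) ↔ ∃ w, R w v ∧ x ∈ e (code w) := by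
  have hmem : ∀ (X : Set T) (x : T), x ∈ (diamond S) X ↔ ∃ y ∈ X, S x y :=
    fun _ _ => Iff.rfl
  simp only [diagram, Term.eval_sup, Term.eval_compl, Term.eval_finsetSup, Term.eval_inf,
    Term.eval_symm, Term.eval_op, Term.eval_var]
  rw [← Set.bot_eq_empty, sup_eq_bot_iff, sup_eq_bot_iff]
  refine and_congr ?_ (and_congr ?_ ?_)
  · rw [compl_eq_bot, Set.top_eq_univ, Set.eq_univ_iff_forall]
    simp only [mem_finset_sup, Finset.mem_univ, true_and]
  · rw [Finset.sup_eq_bot_iff]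
    simp only [Finset.mem_filter, Finset.mem_univ, true_and, Prod.forall]
    refine forall_congr' fun w => forall_congr' fun w' => imp_congr_right fun _ => ?_
    rw [← disjoint_iff, Set.disjoint_left]
  · rw [Finset.sup_eq_bot_iff]
    simp only [Finset.mem_univ, true_imp_iff]
    refine forall_congr' fun v => ?_
    rw [symmDiff_eq_bot, Set.ext_iff]
    simp only [hmem, mem_finset_sup, Finset.mem_filter, Finset.mem_univ, true_and]

/-- The diagram of `(W, R)` is realised in its own complex algebra. -/
theorem eval_diagram_self (R : W → W → Prop) :
    (diagram R).eval (A := Set W) (diamond R) (fun n => {w | code w = n}) = ∅ := by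
  rw [eval_diagram_eq_empty_iff]
  refine ⟨fun x => ⟨x, rfl⟩, fun w w' hw x hx hx' => hw ?_, fun v x => ⟨?_, ?_⟩⟩
  · rw [← code_injective hx, ← code_injective hx']
  · rintro ⟨y, hy, hR⟩
    obtain rfl := code_injective hy
    exact ⟨x, hR, rfl⟩
  · rintro ⟨w, hR, hx⟩
    obtain rfl := code_injective hx
    exact ⟨v, rfl, hR⟩

/-- If the diagram of `(W, R)` is realised in the complex algebra of `(T, S)`, there is a bounded
morphism from `(T, S)` to `(W, R)`. -/
theorem exists_boundedMorphism (R : W → W → Prop) {T : Type u} (S : T → T → Prop)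
    (e : ℕ → Set T) (h : (diagram R).eval (A := Set T) (diamond S) e = ∅) :
    ∃ m : T → W, ∀ x v, (∃ y, S x y ∧ m y = v) ↔ R (m x) v := by
  rw [eval_diagram_eq_empty_iff] at h
  obtain ⟨hcover, hdisj, hrel⟩ := h
  choose m hm using hcover
  have hiff : ∀ x w, x ∈ e (code w) ↔ m x = w := by
    refine fun x w => ⟨fun hx => ?_, fun hx => hx ▸ hm x⟩
    by_contra hne
    exact hdisj _ _ hne x (hm x) hx
  refine ⟨m, fun x v => ?_⟩
  have := hrel v x
  simp only [hiff] at this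
  constructor
  · rintro ⟨y, hxy, hy⟩
    obtain ⟨w, hR, rfl⟩ := this.1 ⟨y, hy, hxy⟩
    exact hR
  · intro hR
    obtain ⟨y, hy, hxy⟩ := this.2 ⟨m x, hR, rfl⟩
    exact ⟨y, hxy, hy⟩

end Diagram

/-! ### Bounded morphisms between wheels -/

theorem wheelRel_rim_rim {n : ℕ} {i j : ZMod n} :
    WheelRel n (.rim i) (.rim j) ↔ i - j = 0 ∨ i - j = 1 ∨ i - j = -1 := Iff.rfl

theorem ZMod.natCast_ne_zero_of_lt {p k : ℕ} (hk : 0 < k) (hkp : k < p) : ((k : ℕ) : ZMod p) ≠ 0 :=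
  fun h => Nat.not_dvd_of_pos_of_lt hk hkp ((ZMod.natCast_eq_zero_iff k p).1 h)

/-- The hub goes to the hub and rim to rim. The two rim neighbours of a point must then hit both rim
neighbours of its image, so the map never turns back: it is `n ↦ φ 0 ± n`, and closing up after `q`
steps gives `q = 0` modulo `p`. -/
theorem dvd_of_wheel_boundedMorphism {p q : ℕ} (hp : 5 ≤ p)
    (m : WheelPoint q → WheelPoint p)
    (hm : ∀ x v, (∃ y, WheelRel q x y ∧ m y = v) ↔ WheelRel p (m x) v) : p ∣ q := by
  have one_ne : (1 : ZMod p) ≠ 0 := by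
    exact_mod_cast ZMod.natCast_ne_zero_of_lt (p := p) (k := 1) (by omega) (by omega)
  have two_ne : (2 : ZMod p) ≠ 0 := by
    exact_mod_cast ZMod.natCast_ne_zero_of_lt (p := p) (k := 2) (by omega) (by omega)
  have three_ne : (3 : ZMod p) ≠ 0 := by
    exact_mod_cast ZMod.natCast_ne_zero_of_lt (p := p) (k := 3) (by omega) (by omega)
  have one_ne_neg : (1 : ZMod p) ≠ -1 := fun h => two_ne (by linear_combination h)
  have hsurj : Function.Surjective m := by
    obtain ⟨u, -, hu⟩ := (hm .hub .hub).2 (wheelRel_hub_right _)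
    intro v
    obtain ⟨y, -, hy⟩ := (hm u v).2 (by rw [hu]; trivial)
    exact ⟨y, hy⟩
  have hhub : m .hub = .hub := by
    rcases h : m .hub with i | _
    -- The image of the hub sees every point, but `rim i` does not see `rim (i + 2)`.
    · exfalso
      obtain ⟨y, hy⟩ := hsurj (.rim (i + 2))
      have := (hm .hub (.rim (i + 2))).1 ⟨y, trivial, hy⟩
      rw [h, wheelRel_rim_rim] at this
      rcases this with h | h | h
      · exact two_ne (by linear_combination -h)
      · exact three_ne (by linear_combination -h)
      · exact one_ne (by linear_combination -h)
    · rfl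
  have hrim : ∀ i, ∃ j, m (.rim i) = .rim j := by
    intro i
    rcases h : m (.rim i) with j | _
    · exact ⟨j, rfl⟩
    · exfalso
      -- If `rim i` went to the hub, its two rim neighbours alone would have to cover the whole rim
      -- of the p-wheel, which has at least three points.
      have hcov : ∀ j : ZMod p, m (.rim (i - 1)) = .rim j ∨ m (.rim (i + 1)) = .rim j := by
        intro j
        obtain ⟨y, hxy, hy⟩ := (hm (.rim i) (.rim j)).2 (by rw [h]; trivial)
        rcases y with k | _
        · rcases wheelRel_rim_rim.1 hxy with hk | hk | hk
          · obtain rfl : i = k := by linear_combination hk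
            rw [h] at hy; cases hy
          · left; rw [← hy]; congr 2; linear_combination hk
          · right; rw [← hy]; congr 2; linear_combination hk
        · rw [hhub] at hy; cases hy
      have inj : ∀ {v : WheelPoint p} {a b : ZMod p}, v = .rim a → v = .rim b → a = b := by
        rintro v a b rfl h; injection h
      have h21 : (2 : ZMod p) ≠ 1 := fun h => one_ne (by linear_combination h)
      rcases hcov 0 with h0 | h0 <;> rcases hcov 1 with h1 | h1 <;> rcases hcov 2 with h2 | h2 <;>
      first
        | exact one_ne (inj h1 h0)
        | exact two_ne (inj h2 h0)
        | exact h21 (inj h2 h1)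
  choose φ hφ using hrim
  have hstep : ∀ (i : ZMod q) (d : ZMod p), (d = 1 ∨ d = -1) →
      φ (i + 1) = φ i + d ∨ φ (i - 1) = φ i + d := by
    intro i d hd
    obtain ⟨y, hxy, hy⟩ := (hm (.rim i) (.rim (φ i + d))).2 (by
      rw [hφ, wheelRel_rim_rim]
      rcases hd with rfl | rfl
      · right; right; ring
      · right; left; ring)
    rcases y with k | _
    · rw [hφ] at hy
      injection hy with hy
      rcases wheelRel_rim_rim.1 hxy with hk | hk | hk
      · obtain rfl : i = k := by linear_combination hk
        exfalso
        have : d = 0 := by linear_combination -hy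
        rcases hd with rfl | rfl
        · exact one_ne this
        · exact one_ne (by linear_combination -this)
      · right; rw [← hy]; congr 1; linear_combination hk
      · left; rw [← hy]; congr 1; linear_combination hk
    · rw [hhub] at hy; cases hy
  -- The neighbour `i` already has value `φ (i + 1) - d`, so `φ (i + 1) + d` must be attained at the
  -- other one.
  have hdir : ∀ (i : ZMod q) (d : ZMod p), (d = 1 ∨ d = -1) → φ (i + 1) = φ i + d →
      φ (i + 1 + 1) = φ (i + 1) + d := by
    intro i d hd hi
    rcases hstep (i + 1) d hd with h | h
    · exact h
    · exfalso
      rw [add_sub_cancel_right, hi] at h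
      have : 2 * d = 0 := by linear_combination -h
      rcases hd with rfl | rfl
      · exact two_ne (by linear_combination this)
      · exact two_ne (by linear_combination -this)
  obtain ⟨d, hd, h0⟩ : ∃ d : ZMod p, (d = 1 ∨ d = -1) ∧ φ (0 + 1) = φ 0 + d := by
    rcases hstep 0 1 (Or.inl rfl) with h | h
    · exact ⟨1, Or.inl rfl, h⟩
    · rcases hstep 0 (-1) (Or.inr rfl) with h' | h'
      · exact ⟨-1, Or.inr rfl, h'⟩
      · exact absurd (add_left_cancel (h.symm.trans h')) one_ne_neg
  have hind : ∀ n : ℕ, φ (n : ZMod q) = φ 0 + n * d ∧ φ ((n : ZMod q) + 1) = φ n + d := by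
    intro n
    induction n with
    | zero => simpa using h0
    | succ n ih =>
      push_cast
      refine ⟨?_, hdir _ _ hd ih.2⟩
      rw [ih.2, ih.1]; ring
  have := (hind q).1
  rw [ZMod.natCast_self] at this
  have hq : (q : ZMod p) = 0 := by
    rcases hd with rfl | rfl
    · linear_combination -this
    · linear_combination this
  exact (ZMod.natCast_eq_zero_iff q p).1 hq

/-! ### Separating the varieties -/

instance {p : ℕ} [NeZero p] : Finite (WheelPoint p) :=
  Finite.of_injective
    (fun w : WheelPoint p => WheelPoint.casesOn (motive := fun _ => Option (ZMod p)) w some none)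
    (by rintro (i | _) (j | _) h <;> simp_all)

noncomputable instance {p : ℕ} [NeZero p] : Fintype (WheelPoint p) := Fintype.ofFinite _

/-- An equation that holds in the example algebra and in the wheel algebras whose size is not
divisible by `p`, but fails in the wheel algebra of size `p`. -/
noncomputable def wheelEquation (p : ℕ) [NeZero p] : Equation :=
  (.inf (.compl (.op (.op (diagram (WheelRel p)))))
    (.sdiff (.op (.op (.var (code (WheelPoint.rim 0 : WheelPoint p)))))
      (.op (.var (code (WheelPoint.rim 0 : WheelPoint p))))), .zero)

/-- The operation is idempotent, so the factor `f (f y) \ f y` vanishes. -/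
theorem exampleAlgebra_satisfies_wheelEquation (p : ℕ) [NeZero p] :
    exampleAlgebra.Satisfies (wheelEquation p) := by
  intro e
  have h : ∀ X : exampleAlgebra, exampleAlgebra.f (exampleAlgebra.f X) = exampleAlgebra.f X :=
    (by decide : ∀ X, exampleOp (exampleOp X) = exampleOp X)
  simp [wheelEquation, h]

theorem wheelAlgebra_satisfies_wheelEquation {p q : ℕ} [NeZero p] (hp : 5 ≤ p) (hpq : ¬ p ∣ q) :
    (wheelAlgebra q).Satisfies (wheelEquation p) := by
  intro e
  have hne : (diagram (WheelRel p)).eval (wheelAlgebra q).f e ≠ ⊥ := by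
    intro h
    obtain ⟨m, hm⟩ := exists_boundedMorphism (WheelRel p) (WheelRel q) e h
    exact hpq (dvd_of_wheel_boundedMorphism hp m hm)
  simp [wheelEquation, wheelAlgebra_op_op q _ hne]

/-- Under the tautological valuation the diagram vanishes, and `f (f y) \ f y` contains `rim 2`,
which is not adjacent to `rim 0`. -/
theorem wheelAlgebra_not_satisfies_wheelEquation {p : ℕ} [NeZero p] (hp : 5 ≤ p) :
    ¬ (wheelAlgebra p).Satisfies (wheelEquation p) := by
  intro h
  let e : ℕ → wheelAlgebra p := fun n => ({w | code w = n} : Set (WheelPoint p))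
  have hD : (diagram (WheelRel p)).eval (wheelAlgebra p).f e = ⊥ :=
    eval_diagram_self (WheelRel p)
  have hy : e (code (WheelPoint.rim 0 : WheelPoint p)) ≠ ⊥ :=
    Set.nonempty_iff_ne_empty.1 ⟨WheelPoint.rim 0, rfl⟩
  have := h e
  simp only [wheelEquation, Term.eval_inf, Term.eval_compl, Term.eval_op, Term.eval_sdiff,
    Term.eval_var, Term.eval_zero, hD, wheelAlgebra_op_bot, wheelAlgebra_op_op p _ hy, compl_bot,
    top_inf_eq, top_sdiff', hnot_eq_compl, compl_eq_bot] at this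
  have hmem : WheelPoint.rim 2 ∈
      diamond (WheelRel p) (e (code (WheelPoint.rim 0 : WheelPoint p))) := by
    rw [show diamond (WheelRel p) (e (code (WheelPoint.rim 0 : WheelPoint p))) = Set.univ from this]
    trivial
  obtain ⟨v, hv, hR⟩ := hmem
  obtain rfl := code_injective hv
  rw [wheelRel_rim_rim] at hR
  have hne : ∀ k : ℕ, 0 < k → k < 5 → (k : ZMod p) ≠ 0 := fun k h0 h5 =>
    ZMod.natCast_ne_zero_of_lt h0 (h5.trans_le hp)
  rcases hR with h | h | h
  · exact hne 2 (by norm_num) (by norm_num) (by push_cast; linear_combination h)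
  · exact hne 1 (by norm_num) (by norm_num) (by push_cast; linear_combination h)
  · exact hne 3 (by norm_num) (by norm_num) (by push_cast; linear_combination h)

theorem subset_of_wheelVariety_subset {X Y : Set ℕ} (hX : X ⊆ Prim) (hY : Y ⊆ Prim)
    (h : wheelVariety.{u} X ⊆ wheelVariety.{u} Y) : X ⊆ Y := by
  intro p hp
  by_contra hpY
  obtain ⟨hprime, h5⟩ := hX hp
  have : NeZero p := ⟨hprime.ne_zero⟩
  have hmem : lift.{u} (wheelAlgebra p) ∈ wheelVariety.{u} X :=
    lift_mem_generatedVariety (Or.inl ⟨p, hp, rfl⟩)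
  refine wheelAlgebra_not_satisfies_wheelEquation h5 (lift_satisfies_iff.1 (h hmem _ ?_))
  rintro _ (⟨q, hq, rfl⟩ | rfl)
  · refine wheelAlgebra_satisfies_wheelEquation h5 fun hdvd => hpY ?_
    rwa [(Nat.prime_dvd_prime_iff_eq hprime (hY hq).1).1 hdvd]
  · exact exampleAlgebra_satisfies_wheelEquation p

theorem wheelVariety_injOn {X Y : Set ℕ} (hX : X ⊆ Prim) (hY : Y ⊆ Prim)
    (h : wheelVariety.{u} X = wheelVariety.{u} Y) : X = Y :=
  (subset_of_wheelVariety_subset hX hY h.subset).antisymm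
    (subset_of_wheelVariety_subset hY hX h.superset)

/-! ### Counting varieties -/

instance Term.countable {α : Type w} [Countable α] : Countable (Term α) := by
  -- Polish notation; `key` is unique readability, with arbitrary suffixes so that the induction
  -- passes through `inf`.
  let enc : Term α → List (α ⊕ Fin 4) := fun t =>
    Term.rec (motive := fun _ => List (α ⊕ Fin 4)) (fun i => [.inl i]) [.inr 0]
      (fun _ _ a b => .inr 1 :: (a ++ b)) (fun _ a => .inr 2 :: a) (fun _ a => .inr 3 :: a) t
  have key : ∀ (s t : Term α) (k l : List (α ⊕ Fin 4)), enc s ++ k = enc t ++ l →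
      s = t ∧ k = l := by
    intro s
    induction s with
    | var i => intro t k l h; cases t <;> simp_all [enc]
    | zero => intro t k l h; cases t <;> simp_all [enc]
    | inf s s' hs hs' =>
      intro t k l h
      cases t with
      | inf t t' =>
        have h' : enc s ++ (enc s' ++ k) = enc t ++ (enc t' ++ l) := by
          simpa [enc] using h
        obtain ⟨rfl, h2⟩ := hs _ _ _ h'
        obtain ⟨rfl, rfl⟩ := hs' _ _ _ h2
        exact ⟨rfl, rfl⟩
      | _ => simp [enc] at h
    | compl s hs =>
      intro t k l h
      cases t with
      | compl t =>
        obtain ⟨rfl, rfl⟩ := hs t k l (by simpa [enc] using h)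
        exact ⟨rfl, rfl⟩
      | _ => simp [enc] at h
    | op s hs =>
      intro t k l h
      cases t with
      | op t =>
        obtain ⟨rfl, rfl⟩ := hs t k l (by simpa [enc] using h)
        exact ⟨rfl, rfl⟩
      | _ => simp [enc] at h
  exact Function.Injective.countable (f := enc) fun s t h => (key s t [] [] (by rw [h])).1

open Cardinal in
theorem mk_varieties_le (P : Set BooleanFrame.{u} → Prop) (hP : ∀ V, P V → IsVariety V) :
    #{V : Set BooleanFrame.{u} // P V} ≤ 𝔠 := by
  choose E hE using fun V : {V : Set BooleanFrame.{u} // P V} => hP V.1 V.2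
  have hinj : Function.Injective E := fun V V' h => Subtype.ext (by rw [hE V, hE V', h])
  have h1 := mk_le_of_injective (ULift.up_injective.comp hinj : Function.Injective
    (ULift.up.{u + 1} ∘ E))
  refine h1.trans ?_
  rw [mk_uLift, mk_set, lift_power, lift_two, ← two_power_aleph0]
  exact power_le_power_left two_ne_zero (lift_le_aleph0.2 (mk_le_aleph0_iff.2 inferInstance))

open Cardinal in
theorem le_mk_varieties (P : Set BooleanFrame.{u} → Prop)
    (hP : ∀ X : Set ℕ, X ⊆ Prim → X.Nonempty → P (wheelVariety.{u} X)) :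
    𝔠 ≤ #{V : Set BooleanFrame.{u} // P V} := by
  let S : Set ℕ := {p | p.Prime} \ Set.Iic 5
  have hS : S.Infinite := Nat.infinite_setOfPred_prime.sdiff (Set.finite_Iic 5)
  -- The prime 5 is always included to keep the set nonempty; the primes above 5 are chosen freely.
  let X : Set S → Set ℕ := fun T => insert 5 ((↑) '' T)
  have hX : ∀ T, X T ⊆ Prim := by
    rintro T _ (rfl | ⟨⟨p, hp, h5⟩, -, rfl⟩)
    · exact ⟨by norm_num, le_rfl⟩
    · exact ⟨hp, (not_le.1 h5).le⟩
  have hXinj : Function.Injective X := by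
    intro T T' h
    have hpre : ∀ T : Set S, (fun s : S => (s : ℕ)) ⁻¹' X T = T := by
      intro T
      ext s
      have : (s : ℕ) ≠ 5 := fun h => s.2.2 h.le
      simp [X, this]
    rw [← hpre T, h, hpre]
  have hinj : Function.Injective fun T : ULift.{u + 1} (Set S) =>
      (⟨wheelVariety.{u} (X T.down), hP _ (hX _) (Set.insert_nonempty _ _)⟩ :
        {V : Set BooleanFrame.{u} // P V}) := fun T T' h =>
    ULift.down_injective (hXinj (wheelVariety_injOn (hX _) (hX _) (congrArg Subtype.val h)))
  refine le_trans ?_ (mk_le_of_injective hinj)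
  have := hS.to_subtype
  rw [mk_uLift, mk_set, lift_power, lift_two, ← two_power_aleph0]
  exact power_le_power_left two_ne_zero (aleph0_le_lift.2 (aleph0_le_mk S))

end BooleanFrame

theorem mainTheorem4 :
    (∀ X : Set ℕ, X ⊆ BooleanFrame.Prim → X.Nonempty →
      BooleanFrame.IsVariety (BooleanFrame.wheelVariety.{u} X) ∧
      BooleanFrame.StronglyNonAdditive (BooleanFrame.wheelVariety.{u} X) ∧
      BooleanFrame.ClassMonotone (BooleanFrame.wheelVariety.{u} X) ∧
      BooleanFrame.ClassHasCEP (BooleanFrame.wheelVariety.{u} X)) ∧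
    (∀ X Y : Set ℕ, X ⊆ BooleanFrame.Prim → X.Nonempty → Y ⊆ BooleanFrame.Prim → Y.Nonempty →
      X ≠ Y → BooleanFrame.wheelVariety.{u} X ≠ BooleanFrame.wheelVariety.{u} Y) ∧
    Cardinal.mk {V : Set BooleanFrame.{u} // BooleanFrame.IsVariety V ∧
      BooleanFrame.StronglyNonAdditive V ∧ BooleanFrame.ClassMonotone V ∧
      BooleanFrame.ClassHasCEP V} = Cardinal.continuum := by
  have h1 : ∀ X : Set ℕ, X ⊆ BooleanFrame.Prim → X.Nonempty →
      BooleanFrame.IsVariety (BooleanFrame.wheelVariety.{u} X) ∧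
      BooleanFrame.StronglyNonAdditive (BooleanFrame.wheelVariety.{u} X) ∧
      BooleanFrame.ClassMonotone (BooleanFrame.wheelVariety.{u} X) ∧
      BooleanFrame.ClassHasCEP (BooleanFrame.wheelVariety.{u} X) := fun X _ _ =>
    ⟨BooleanFrame.generatedVariety_isVariety _, BooleanFrame.wheelVariety_stronglyNonAdditive X,
      BooleanFrame.wheelVariety_monotone X, BooleanFrame.wheelVariety_hasCEP X⟩
  exact ⟨h1, fun X Y hX _ hY _ hne h => hne (BooleanFrame.wheelVariety_injOn hX hY h),
    (BooleanFrame.mk_varieties_le _ fun _ h => h.1).antisymm (BooleanFrame.le_mk_varieties _ h1)⟩
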